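/- Let $S$ be a separable metrizable space and $A$ a nonempty metrizable space, both with their Borel $\sigma$-algebras. Let $P(\cdot\mid s,a)$ be a Markov kernel from $S\times A$ to $S$, let $c,l:S\times A\to[0,\infty)$ be a task cost and a safety cost, with $l$ measurable, and let $\gamma_c,\gamma_l\in(0,1)$. For $n\in\{0,1,2,\dots\}\cup\{\infty\}$ the safety augmented (Saute) MDP $\widetilde{\mathcal M}_n$ has state space $\widetilde S=S\times\mathbb R$, action space $A$, discount factor $\gamma_c$, transition kernel $\widetilde P(\cdot\mid s,z,a)$ given by $s'\sim P(\cdot\mid s,a)$ and $z'=(z-l(s,a))/\gamma_l$, and cost $$\widetilde c_n(s,z,a)=\begin{cases}c(s,a), & z\ge 0,\\ n, & z<0.\end{cases}$$ Policies may be randomized and may depend measurably on the whole history of states and actions. Let $V_n(\pi,(s,z))=\mathbb E^\pi_{(s,z)}\sum_{t=0}^\infty\gamma_c^t\,\widetilde c_n(s_t,z_t,a_t)\in[0,\infty]$ be the expected discounted cost of the policy $\pi$ started at $(s,z)$, and let $V_n^\ast(s,z)=\inf_\pi V_n(\pi,(s,z))$ be the optimal value. Consider the assumptions: A1 (for a given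 finite $n$). $\widetilde c_n$ is bounded, measurable, nonnegative and lower semicontinuous on $\widetilde S\times A$. A2. $A$ is compact. A3. $\widetilde P$ is weakly continuous: for every bounded continuous $u:\widetilde S\to\mathbb R$ the map $(s,z,a)\mapsto\int u\,d\widetilde P(\cdot\mid s,z,a)$ is continuous on $\widetilde S\times A$. Assume A2 and A3. Then: (a) For every finite $n$ for which A1 holds, $V_n^\ast$ is bounded and measurable and satisfies the Bellman equation $$V_n^\ast(s,z)=\min_{a\in A}\Big(\widetilde c_n(s,z,a)+\gamma_c\int V_n^\ast\,d\widetilde P(\cdot\mid s,z,a)\Big)\qquad\text{for all }(s,z)\in\widetilde S,$$ the minimum being attained. Moreover there is an optimal policy that is stationary and Markov in the augmented state, $a_t\sim\pi_n^\ast(\cdot\mid s_t,z_t)$: it attains $V_n^\ast(s,z)$ from every initial state $(s,z)$, and it minimizes the expected discounted cost over all policies for every initial distribution. (b) If A1 holds for some finite $n$, then for every $(s,z)$ the sequence $V_0^\ast(s,z),V_1^\ast(s,z),V_2^\ast(s,z),\dots$ is nondecreasing and converges in $[0,\infty]$ to $V_\infty^\ast(s,z)$, the optimal value of the limiting MDP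 $\widetilde{\mathcal M}_\infty$, whose cost is $+\infty$ when $z<0$. -/

import Mathlib

open MeasureTheory ProbabilityTheory Filter Topology
open scoped ENNReal NNReal BoundedContinuousFunction

noncomputable section

/-- An infinite-horizon discounted Markov decision process with state space `X` and action space
`A`. The cost takes values in `[0, ∞]`. -/
structure MDP (X A : Type*) [MeasurableSpace X] [MeasurableSpace A] where
  /-- the transition law `x' ∼ p(· | x, a)` -/
  trans : Kernel (X × A) X
  isMarkovKernel_trans : IsMarkovKernel trans
  /-- the instantaneous cost -/
  cost : X × A → ℝ≥0∞
  /-- the discount factor, in `(0, 1)` -/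
  discount : ℝ≥0
  discount_pos : 0 < discount
  discount_lt_one : discount < 1

attribute [instance] MDP.isMarkovKernel_trans

/-- A randomized history-dependent policy: at time `t` it draws the action `a_t` from a
distribution that depends measurably on the history `((x_0, a_0), …, (x_{t-1}, a_{t-1}))` and on
the present state `x_t`. -/
structure Policy (X A : Type*) [MeasurableSpace X] [MeasurableSpace A] where
  act : (t : ℕ) → Kernel ((Fin t → X × A) × X) A
  isMarkovKernel_act : ∀ t, IsMarkovKernel (act t)

attribute [instance] Policy.isMarkovKernel_act

namespace Policy

variable {X A : Type*} [MeasurableSpace X] [MeasurableSpace A]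

/-- The stationary Markov policy `a_t ∼ π(· | x_t)`. -/
def markov (π : Kernel X A) [IsMarkovKernel π] : Policy X A where
  act _ := π.comap Prod.snd measurable_snd
  isMarkovKernel_act _ := inferInstance

end Policy

namespace MDP

variable {X A : Type*} [MeasurableSpace X] [MeasurableSpace A]

/-- Given the state-action pairs up to time `t` and the state at time `t + 1`, the data available
to the policy at time `t + 1`. -/
def toHistory (t : ℕ) (h : (Π _ : Finset.Iic t, X × A) × X) : (Fin (t + 1) → X × A) × X :=
  (fun i => h.1 ⟨i, Finset.mem_Iic.2 (Nat.lt_succ_iff.1 i.2)⟩, h.2)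

lemma measurable_toHistory (t : ℕ) : Measurable (toHistory (X := X) (A := A) t) := by
  unfold toHistory
  fun_prop

/-- The conditional law of `(x_{t+1}, a_{t+1})` given `(x_0, a_0), …, (x_t, a_t)`:
`x_{t+1} ∼ p(· | x_t, a_t)` and then `a_{t+1}` is drawn by the policy. -/
def step (M : MDP X A) (π : Policy X A) (t : ℕ) : Kernel (Π _ : Finset.Iic t, X × A) (X × A) :=
  (M.trans.comap (fun h : (Π _ : Finset.Iic t, X × A) => h ⟨t, Finset.mem_Iic.2 le_rfl⟩)
      (measurable_pi_apply _)) ⊗ₖ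
    ((π.act (t + 1)).comap (toHistory t) (measurable_toHistory t))

instance (M : MDP X A) (π : Policy X A) (t : ℕ) : IsMarkovKernel (M.step π t) := by
  unfold step
  infer_instance

/-- The joint law of `(x_0, a_0)` when `x_0 ∼ μ₀`. -/
def initLaw (π : Policy X A) (μ₀ : Measure X) : Measure (X × A) :=
  μ₀ ⊗ₘ ((π.act 0).comap (fun x => (Fin.elim0, x)) (by fun_prop))

/-- The law of the trajectory `((x_t, a_t))_{t ∈ ℕ}` under the policy `π` with initial
distribution `μ₀` (Ionescu-Tulcea). -/
def law (M : MDP X A) (π : Policy X A) (μ₀ : Measure X) : Measure (ℕ → X × A) :=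
  Kernel.trajMeasure (X := fun _ => X × A) (initLaw π μ₀) (M.step π)

/-- The expected discounted cost `𝔼 ∑ₜ γᵗ c(x_t, a_t)` with initial distribution `μ₀`. -/
def expectedCost (M : MDP X A) (π : Policy X A) (μ₀ : Measure X) : ℝ≥0∞ :=
  ∫⁻ ω, ∑' t : ℕ, (M.discount : ℝ≥0∞) ^ t * M.cost (ω t) ∂(M.law π μ₀)

/-- The value `V(π, x)` of a policy from the initial state `x`. -/
def value (M : MDP X A) (π : Policy X A) (x : X) : ℝ≥0∞ :=
  M.expectedCost π (Measure.dirac x)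

/-- The optimal value `V*(x)`: the infimum of `V(π, x)` over all policies. -/
def optValue (M : MDP X A) (x : X) : ℝ≥0∞ :=
  ⨅ π : Policy X A, M.value π x

/-- The policy `π` solves the MDP: it attains the optimal value from every initial state, and it
minimizes the expected discounted cost for every initial distribution. -/
def IsOptimal (M : MDP X A) (π : Policy X A) : Prop :=
  (∀ x, M.value π x = M.optValue x) ∧
    ∀ μ₀ : Measure X, IsProbabilityMeasure μ₀ →
      ∀ π' : Policy X A, M.expectedCost π μ₀ ≤ M.expectedCost π' μ₀

/-- `V` satisfies the Bellman equation `V(x) = min_a (c(x, a) + γ 𝔼_{x' ∼ p(· | x, a)} V(x'))`,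
where the minimum is attained. -/
def SatisfiesBellman (M : MDP X A) (V : X → ℝ≥0∞) : Prop :=
  ∀ x, IsLeast
    (Set.range fun a : A => M.cost (x, a) + M.discount * ∫⁻ x', V x' ∂(M.trans (x, a))) (V x)

end MDP

/-- A constrained MDP `⟨S, A, P, c, γ_c, l, γ_l⟩` with task cost `c`, safety cost `l`, and
discount factors in `(0, 1)`. -/
structure CMDP (S A : Type*) [MeasurableSpace S] [MeasurableSpace A] where
  trans : Kernel (S × A) S
  isMarkovKernel_trans : IsMarkovKernel trans
  cost : S × A → ℝ≥0
  discount : ℝ≥0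
  discount_pos : 0 < discount
  discount_lt_one : discount < 1
  safetyCost : S × A → ℝ≥0
  measurable_safetyCost : Measurable safetyCost
  safetyDiscount : ℝ≥0
  safetyDiscount_pos : 0 < safetyDiscount
  safetyDiscount_lt_one : safetyDiscount < 1

attribute [instance] CMDP.isMarkovKernel_trans

namespace CMDP

variable {S A : Type*} [MeasurableSpace S] [MeasurableSpace A]

/-- The update `z' = (z - l(s, a)) / γ_l` of the remaining safety budget. -/
def budgetUpdate (M : CMDP S A) (p : (S × ℝ) × A) : ℝ :=
  (p.1.2 - M.safetyCost (p.1.1, p.2)) / M.safetyDiscount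

lemma measurable_budgetUpdate (M : CMDP S A) : Measurable M.budgetUpdate := by
  have h : Measurable fun p : (S × ℝ) × A => M.safetyCost (p.1.1, p.2) :=
    M.measurable_safetyCost.comp (by fun_prop)
  unfold budgetUpdate
  fun_prop

/-- The transition law of the augmented state `(s, z)`: `s' ∼ p(· | s, a)` and
`z' = (z - l(s, a)) / γ_l`. -/
def sauteTrans (M : CMDP S A) : Kernel ((S × ℝ) × A) (S × ℝ) :=
  (M.trans.comap (fun p : (S × ℝ) × A => (p.1.1, p.2)) (by fun_prop)) ×ₖ
    Kernel.deterministic M.budgetUpdate M.measurable_budgetUpdate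

instance (M : CMDP S A) : IsMarkovKernel M.sauteTrans := by
  unfold sauteTrans
  infer_instance

open Classical in
/-- The reshaped cost: `c(s, a)` if `z ≥ 0`, and `n` if `z < 0`. For `n = ⊤` this is the cost
with value `+∞` on `z < 0`. -/
def sauteCost (M : CMDP S A) (n : ℕ∞) (p : (S × ℝ) × A) : ℝ≥0∞ :=
  if 0 ≤ p.1.2 then (M.cost (p.1.1, p.2) : ℝ≥0∞) else (n : ℝ≥0∞)

/-- The safety augmented (Saute) MDP with parameter `n`; `n = ⊤` is the limiting MDP. -/
def saute (M : CMDP S A) (n : ℕ∞) : MDP (S × ℝ) A where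
  trans := M.sauteTrans
  isMarkovKernel_trans := inferInstance
  cost := M.sauteCost n
  discount := M.discount
  discount_pos := M.discount_pos
  discount_lt_one := M.discount_lt_one

/-- The reshaped cost with parameter `n` is bounded, measurable, (nonnegative) and lower
semicontinuous in `((s, z), a)`. -/
structure RegularCost [TopologicalSpace S] [TopologicalSpace A] (M : CMDP S A) (n : ℕ) :
    Prop where
  bounded : ∃ C : ℝ≥0, ∀ p, M.sauteCost n p ≤ C
  measurable : Measurable (M.sauteCost n)
  lowerSemicontinuous : LowerSemicontinuous (M.sauteCost n)

/-- Weak continuity of the transition law of the augmented state. -/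
def WeaklyContinuous [TopologicalSpace S] [TopologicalSpace A] (M : CMDP S A) : Prop :=
  ∀ u : (S × ℝ) →ᵇ ℝ, Continuous fun p : (S × ℝ) × A => ∫ y, u y ∂(M.sauteTrans p)

end CMDP

end

/-! Everything rests on monotone limits of lower semicontinuous functions; no contraction argument
is used, so infinite costs do no harm. Weak continuity makes `∫ V dP` lower semicontinuous when `V`
is, and minimizing over the compact `A` preserves this. Hence value iteration from `0` gives an
increasing sequence of lower semicontinuous functions. By compactness the minimum commutes with
increasing limits (`iInf_iSup_eq_iSup_iInf_of_lowerSemicontinuous`), so their supremum `V` solves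
the Bellman equation.

Every iterate is a lower bound for the cost of every policy (`lintegral_le_expectedCost`), hence so
is `V`. A measurable minimizer in the Bellman equation exists by `exists_measurable_selector`, and
its stationary policy costs at most `V`, because the remaining terminal cost is nonnegative and can
be dropped. So `V` is the optimal value and that policy is optimal.

For (b), the finite-`n` optimal values increase and are at most the limiting one. By the same
interchange their supremum solves the limiting Bellman equation, and a measurable minimizer there
yields a policy whose cost is at most this supremum. Uniqueness of Bellman solutions is never
needed. -/

/-! ### Lower semicontinuity -/

section LowerSemicontinuity

/-- The value of a weakly continuous Markov kernel on an open set is lower semicontinuous. -/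
lemma ProbabilityTheory.Kernel.lowerSemicontinuous_apply_of_isOpen {X Y : Type*}
    [TopologicalSpace X] [MeasurableSpace X] [OpensMeasurableSpace X] [HasOuterApproxClosed X]
    [TopologicalSpace Y] [MeasurableSpace Y] (κ : Kernel Y X) [IsMarkovKernel κ]
    (hκ : ∀ u : X →ᵇ ℝ, Continuous fun y => ∫ x, u x ∂(κ y)) {G : Set X} (hG : IsOpen G) :
    LowerSemicontinuous fun y => κ y G := by
  rw [lowerSemicontinuous_iff_le_liminf]
  intro y
  let P : Y → ProbabilityMeasure X := fun y => ⟨κ y, inferInstance⟩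
  have hP : Tendsto P (𝓝 y) (𝓝 (P y)) :=
    ProbabilityMeasure.tendsto_iff_forall_integral_tendsto.2 fun u => (hκ u).tendsto y
  exact ProbabilityMeasure.le_liminf_measure_open_of_tendsto hP hG

/-- Integrating a nonnegative lower semicontinuous function against a weakly continuous Markov
kernel gives a lower semicontinuous function. -/
lemma ProbabilityTheory.Kernel.lowerSemicontinuous_lintegral {X Y : Type*}
    [TopologicalSpace X] [MeasurableSpace X] [OpensMeasurableSpace X] [HasOuterApproxClosed X]
    [TopologicalSpace Y] [FirstCountableTopology Y] [MeasurableSpace Y]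
    (κ : Kernel Y X) [IsMarkovKernel κ]
    (hκ : ∀ u : X →ᵇ ℝ, Continuous fun y => ∫ x, u x ∂(κ y)) {f : X → ℝ≥0∞}
    (hf : LowerSemicontinuous f) : LowerSemicontinuous fun y => ∫⁻ x, f x ∂(κ y) := by
  -- The truncation is finite, so the layer-cake formula expresses its integral through the measures
  -- of open superlevel sets. These are lower semicontinuous in `y`, and Fatou's lemma passes this
  -- to the integral over levels.
  have key : ∀ n : ℕ, LowerSemicontinuous fun y => ∫⁻ x, min (f x) n ∂(κ y) := by
    intro n
    have hlt : ∀ t : ℝ, 0 < t →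
        IsOpen {x | t < (min (f x) n).toReal} := by
      intro t ht
      have : {x | t < (min (f x) n).toReal} = {x | ENNReal.ofReal t < min (f x) n} := by
        ext x
        exact (ENNReal.ofReal_lt_iff_lt_toReal ht.le (by simp)).symm
      rw [this]
      exact (hf.inf lowerSemicontinuous_const).isOpen_preimage _
    have heq : ∀ y, ∫⁻ x, min (f x) n ∂(κ y) =
        ∫⁻ t in Set.Ioi (0 : ℝ), κ y {x | t < (min (f x) n).toReal} := by
      intro y
      rw [← lintegral_eq_lintegral_meas_lt _ (ae_of_all _ fun x => ENNReal.toReal_nonneg)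
        (hf.measurable.min measurable_const).ennreal_toReal.aemeasurable]
      refine lintegral_congr fun x => ?_
      rw [ENNReal.ofReal_toReal (by simp)]
    rw [lowerSemicontinuous_iff_le_liminf]
    intro y
    simp_rw [heq]
    refine le_trans ?_ (lintegral_liminf_le fun y' => Antitone.measurable fun s t hst =>
      measure_mono fun x (hx : _ < _) => lt_of_le_of_lt hst hx)
    refine setLIntegral_mono' measurableSet_Ioi fun t ht => ?_
    exact (κ.lowerSemicontinuous_apply_of_isOpen hκ (hlt t ht)).le_liminf y
  have heq : ∀ y, ∫⁻ x, f x ∂(κ y) = ⨆ n : ℕ, ∫⁻ x, min (f x) n ∂(κ y) := by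
    intro y
    rw [← lintegral_iSup (fun n => hf.measurable.min measurable_const)
      fun m n hmn x => min_le_min le_rfl (by exact_mod_cast hmn)]
    refine lintegral_congr fun x => ?_
    refine le_antisymm ?_ (iSup_le fun n => min_le_left _ _)
    refine le_of_forall_lt fun c hc => ?_
    obtain ⟨n, hn⟩ := ENNReal.exists_nat_gt (ne_top_of_lt hc)
    exact lt_of_lt_of_le (lt_min hc hn) (le_iSup (fun n : ℕ => min (f x) (n : ℝ≥0∞)) n)
  simp_rw [heq]
  exact lowerSemicontinuous_iSup key

variable {X A : Type*} [TopologicalSpace X] [TopologicalSpace A]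

/-- A lower semicontinuous function that is minimized over one compact variable is lower
semicontinuous in the other one. -/
lemma LowerSemicontinuous.iInf_of_compactSpace [CompactSpace A] {f : X × A → ℝ≥0∞}
    (hf : LowerSemicontinuous f) : LowerSemicontinuous fun x => ⨅ a, f (x, a) := by
  intro x y hy
  -- The intermediate `r` is needed because a strict bound for all `a` gives only a weak bound for
  -- the infimum.
  obtain ⟨r, hyr, hr⟩ := exists_between hy
  have h : ∀ᶠ x' in 𝓝 x, ∀ a ∈ (Set.univ : Set A), r < f (x', a) := by
    refine isCompact_univ.eventually_forall_of_forall_eventually fun a _ => ?_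
    exact hf (x, a) r (lt_of_lt_of_le hr (iInf_le _ a))
  filter_upwards [h] with x' hx'
  exact lt_of_lt_of_le hyr (le_iInf fun a => (hx' a trivial).le)

lemma LowerSemicontinuous.exists_eq_iInf [CompactSpace A] [Nonempty A] {f : A → ℝ≥0∞}
    (hf : LowerSemicontinuous f) : ∃ a, f a = ⨅ b, f b := by
  obtain ⟨a, -, ha⟩ := (hf.lowerSemicontinuousOn Set.univ).exists_isMinOn Set.univ_nonempty
    isCompact_univ
  exact ⟨a, le_antisymm (le_iInf fun b => ha (Set.mem_univ b)) (iInf_le _ a)⟩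

/-- Minimizing over a compact space commutes with increasing limits of lower semicontinuous
functions. -/
lemma iInf_iSup_eq_iSup_iInf_of_lowerSemicontinuous [CompactSpace A] [Nonempty A]
    {f : ℕ → A → ℝ≥0∞} (hf : ∀ n, LowerSemicontinuous (f n)) (hmono : Monotone f) :
    ⨅ a, ⨆ n, f n a = ⨆ n, ⨅ a, f n a := by
  refine le_antisymm ?_ (iSup_iInf_le_iInf_iSup _)
  set r := ⨆ n, ⨅ a, f n a
  -- Cantor intersection: the sublevel sets at height `r` decrease, and each contains a minimizer of
  -- `f n`. A common point is a witness for all `n` at once.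
  obtain ⟨a, ha⟩ := IsCompact.nonempty_iInter_of_sequence_nonempty_isCompact_isClosed
    (fun n => {a | f n a ≤ r}) (fun n a (ha : _ ≤ _) => (hmono n.le_succ a).trans ha)
    (fun n => by
      obtain ⟨a, ha⟩ := (hf n).exists_eq_iInf
      exact ⟨a, ha.trans_le (le_iSup (fun n => ⨅ a, f n a) n)⟩)
    ((hf 0).isClosed_preimage r).isCompact fun n => (hf n).isClosed_preimage r
  exact (iInf_le _ a).trans (iSup_le fun n => Set.mem_iInter.1 ha n)

end LowerSemicontinuity

/-! ### Measurable selection -/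

section Selection

variable {X A : Type*} [MeasurableSpace X] [TopologicalSpace A]

/-- A multifunction whose lower inverse images of closed sets are measurable keeps this property
when its values are reduced to the minimizers of a continuous function. -/
lemma measurableSet_nonempty_argmin_inter [CompactSpace A] {F : X → Set A}
    (hF : ∀ x, IsClosed (F x)) (hne : ∀ x, (F x).Nonempty)
    (hmeas : ∀ C, IsClosed C → MeasurableSet {x | (F x ∩ C).Nonempty})
    {g : A → ℝ} (hg : Continuous g) {C : Set A} (hC : IsClosed C) :
    MeasurableSet {x | ({a ∈ F x | ∀ b ∈ F x, g a ≤ g b} ∩ C).Nonempty} := by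
  have hsub : ∀ q : ℝ, IsClosed {a | g a ≤ q} := fun q => isClosed_le hg continuous_const
  -- Some minimizer lies in `C` exactly when the minimum of `g` over `F x ∩ C` is no larger than
  -- over `F x`. This is tested at rational levels.
  have : {x | ({a ∈ F x | ∀ b ∈ F x, g a ≤ g b} ∩ C).Nonempty} =
      ⋂ q : ℚ, ({x | (F x ∩ {a | g a ≤ q}).Nonempty}ᶜ ∪
        {x | (F x ∩ (C ∩ {a | g a ≤ q})).Nonempty}) := by
    ext x
    simp only [Set.mem_iInter, Set.mem_union, Set.mem_compl_iff, Set.mem_ofPred_eq]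
    constructor
    · rintro ⟨a, ⟨haF, hamin⟩, haC⟩ q
      rw [or_iff_not_imp_left, not_not]
      rintro ⟨b, hbF, hbq⟩
      exact ⟨a, haF, haC, (hamin b hbF).trans hbq⟩
    · intro h
      obtain ⟨b, hbF, hb⟩ := (hF x).isCompact.exists_isMinOn (hne x) hg.continuousOn
      have h' : ∀ q : ℚ, g b ≤ q → (F x ∩ (C ∩ {a | g a ≤ q})).Nonempty := fun q hq =>
        (h q).resolve_left fun hn => hn ⟨b, hbF, hq⟩
      obtain ⟨q₀, hq₀⟩ := exists_rat_gt (g b)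
      obtain ⟨c, hcF, hcC, -⟩ := h' q₀ hq₀.le
      obtain ⟨a, ha, hamin⟩ := ((hF x).inter hC).isCompact.exists_isMinOn ⟨c, hcF, hcC⟩
        hg.continuousOn
      have hab : g a ≤ g b := by
        refine le_of_forall_gt_imp_ge_of_dense fun r hr => ?_
        obtain ⟨q, hq₁, hq₂⟩ := exists_rat_btwn hr
        obtain ⟨d, hdF, hdC, hdq⟩ := h' q hq₁.le
        exact ((hamin ⟨hdF, hdC⟩).trans hdq).trans hq₂.le
      exact ⟨a, ⟨ha.1, fun d hd => hab.trans (hb hd)⟩, ha.2⟩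
  rw [this]
  exact MeasurableSet.iInter fun q =>
    (hmeas _ (hsub q)).compl.union (hmeas _ (hC.inter (hsub q)))

/-- The successive minimizers in `F x` of the functions `g 0`, `g 1`, …. -/
def iteratedArgmin (g : ℕ → A → ℝ) (F : X → Set A) : ℕ → X → Set A
  | 0 => F
  | k + 1 => fun x => {a ∈ iteratedArgmin g F k x | ∀ b ∈ iteratedArgmin g F k x, g k a ≤ g k b}

/-- **Measurable selection** in a compact metrizable space: a multifunction with nonempty closed
values whose lower inverse images of closed sets are measurable has a measurable selector. -/
theorem exists_measurable_selector [CompactSpace A] [TopologicalSpace.MetrizableSpace A]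
    [MeasurableSpace A] [BorelSpace A] {F : X → Set A}
    (hF : ∀ x, IsClosed (F x)) (hne : ∀ x, (F x).Nonempty)
    (hmeas : ∀ C, IsClosed C → MeasurableSet {x | (F x ∩ C).Nonempty}) :
    ∃ σ : X → A, Measurable σ ∧ ∀ x, σ x ∈ F x := by
  rcases isEmpty_or_nonempty X with hX | ⟨⟨x₀⟩⟩
  · exact ⟨fun x => hX.elim x, measurable_of_empty _, fun x => hX.elim x⟩
  have : Nonempty A := ⟨(hne x₀).some⟩
  let := TopologicalSpace.metrizableSpaceMetric A
  -- Distances to a dense sequence separate points, so minimizing them successively shrinks `F x` to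
  -- a single point.
  let g : ℕ → A → ℝ := fun k a => dist a (TopologicalSpace.denseSeq A k)
  have hg : ∀ k, Continuous (g k) := fun k => continuous_id.dist continuous_const
  let G := iteratedArgmin g F
  have hGsucc : ∀ k x, G (k + 1) x = {a ∈ G k x | ∀ b ∈ G k x, g k a ≤ g k b} := fun _ _ => rfl
  have hG : ∀ k, (∀ x, IsClosed (G k x)) ∧ (∀ x, (G k x).Nonempty) ∧
      ∀ C, IsClosed C → MeasurableSet {x | (G k x ∩ C).Nonempty} := by
    intro k
    induction k with
    | zero => exact ⟨hF, hne, hmeas⟩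
    | succ k ih =>
      obtain ⟨h₁, h₂, h₃⟩ := ih
      refine ⟨fun x => ?_, fun x => ?_, fun C hC => ?_⟩
      · have : G (k + 1) x = G k x ∩ ⋂ b ∈ G k x, {a | g k a ≤ g k b} := by
          rw [hGsucc]; ext a; simp
        rw [this]
        exact (h₁ x).inter (isClosed_biInter fun b _ => isClosed_le (hg k) continuous_const)
      · obtain ⟨a, ha, hmin⟩ := (h₁ x).isCompact.exists_isMinOn (h₂ x) (hg k).continuousOn
        exact ⟨a, ha, fun b hb => hmin hb⟩
      · exact measurableSet_nonempty_argmin_inter h₁ h₂ h₃ (hg k) hC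
  have hanti : ∀ k x, G (k + 1) x ⊆ G k x := fun k x a ha => ha.1
  have hInter : ∀ x, (⋂ k, G k x).Nonempty := fun x =>
    IsCompact.nonempty_iInter_of_sequence_nonempty_isCompact_isClosed _ (fun k => hanti k x)
      (fun k => (hG k).2.1 x) ((hG 0).1 x).isCompact fun k => (hG k).1 x
  have huniq : ∀ x, ∀ a ∈ ⋂ k, G k x, ∀ b ∈ ⋂ k, G k x, a = b := by
    intro x a ha b hb
    rw [Set.mem_iInter] at ha hb
    have hk : ∀ k, g k a = g k b := fun k =>
      le_antisymm ((ha (k + 1)).2 b (hb k)) ((hb (k + 1)).2 a (ha k))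
    have hall : (fun c => dist a c) = fun c => dist b c :=
      (TopologicalSpace.denseRange_denseSeq A).equalizer (by fun_prop) (by fun_prop)
        (funext hk)
    have := congrFun hall b
    simpa using this
  choose σ hσ using hInter
  refine ⟨σ, measurable_of_isClosed fun C hC => ?_, fun x => Set.mem_iInter.1 (hσ x) 0⟩
  -- If every `G k x` meets `C`, compactness gives a point of `C` in all of them, and this can only
  -- be `σ x`.
  have : σ ⁻¹' C = ⋂ k, {x | (G k x ∩ C).Nonempty} := by
    ext x
    simp only [Set.mem_preimage, Set.mem_iInter, Set.mem_ofPred_eq]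
    constructor
    · exact fun h k => ⟨σ x, Set.mem_iInter.1 (hσ x) k, h⟩
    · intro h
      obtain ⟨a, ha⟩ := IsCompact.nonempty_iInter_of_sequence_nonempty_isCompact_isClosed
        (fun k => G k x ∩ C) (fun k => Set.inter_subset_inter_left _ (hanti k x)) h
        (((hG 0).1 x).inter hC).isCompact fun k => ((hG k).1 x).inter hC
      rw [Set.mem_iInter] at ha
      have hax : a ∈ ⋂ k, G k x := Set.mem_iInter.2 fun k => (ha k).1
      rw [huniq x _ (hσ x) a hax]
      exact (ha 0).2
  rw [this]
  exact MeasurableSet.iInter fun k => (hG k).2.2 C hC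

/-- A measurable selector of a sublevel set of a lower semicontinuous function. -/
theorem LowerSemicontinuous.exists_measurable_le [TopologicalSpace X] [OpensMeasurableSpace X]
    [CompactSpace A] [TopologicalSpace.MetrizableSpace A] [MeasurableSpace A] [BorelSpace A]
    {f : X × A → ℝ≥0∞} (hf : LowerSemicontinuous f) {V : X → ℝ≥0∞} (hV : Measurable V)
    (h : ∀ x, ∃ a, f (x, a) ≤ V x) : ∃ σ : X → A, Measurable σ ∧ ∀ x, f (x, σ x) ≤ V x := by
  have hfx : ∀ x, LowerSemicontinuous fun a => f (x, a) := fun x =>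
    hf.comp (g := fun a => (x, a)) (by fun_prop)
  refine exists_measurable_selector (F := fun x => {a | f (x, a) ≤ V x})
    (fun x => (hfx x).isClosed_preimage _) h fun C hC => ?_
  -- The empty set is separate: an infimum over it is `∞`, which would pass the test `≤ V x`
  -- wherever `V x = ∞`.
  rcases C.eq_empty_or_nonempty with rfl | hCne
  · simp
  have : CompactSpace C := isCompact_iff_compactSpace.1 hC.isCompact
  have : Nonempty C := hCne.to_subtype
  let fC : X × C → ℝ≥0∞ := fun p => f (p.1, p.2)
  have hfC : LowerSemicontinuous fC := hf.comp (g := fun p : X × C => (p.1, (p.2 : A))) (by fun_prop)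
  have : {x | ({a | f (x, a) ≤ V x} ∩ C).Nonempty} = {x | ⨅ a, fC (x, a) ≤ V x} := by
    ext x
    constructor
    · rintro ⟨a, ha, haC⟩
      exact le_trans (iInf_le (fun a => fC (x, a)) ⟨a, haC⟩) ha
    · intro hx
      obtain ⟨a, ha⟩ := LowerSemicontinuous.exists_eq_iInf (f := fun a => fC (x, a))
        (hfC.comp (g := fun a => (x, a)) (by fun_prop))
      exact ⟨a, ha.trans_le hx, a.2⟩
  rw [this]
  exact measurableSet_le hfC.iInf_of_compactSpace.measurable hV

end Selection

/-! ### Discounted Markov decision processes with lower semicontinuous costs -/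

namespace MDP

section Trajectories

variable {X A : Type*} [MeasurableSpace X] [MeasurableSpace A]

lemma isProbabilityMeasure_initLaw (π : Policy X A) (μ₀ : Measure X) [IsProbabilityMeasure μ₀] :
    IsProbabilityMeasure (initLaw π μ₀) := by
  unfold initLaw
  infer_instance

lemma lintegral_law_zero (M : MDP X A) (π : Policy X A) (μ₀ : Measure X) [IsProbabilityMeasure μ₀]
    {g : X × A → ℝ≥0∞} (hg : Measurable g) :
    ∫⁻ ω, g (ω 0) ∂(M.law π μ₀) = ∫⁻ x, ∫⁻ a, g (x, a) ∂(π.act 0 (Fin.elim0, x)) ∂μ₀ := by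
  have hmap : (M.law π μ₀).map (fun ω => ω 0) = initLaw π μ₀ := by
    have h0 : (fun ω : ℕ → X × A => ω 0) =
        (MeasurableEquiv.piUnique fun _ : Finset.Iic 0 => X × A) ∘ Preorder.frestrictLe 0 := rfl
    rw [h0, ← Measure.map_map (by fun_prop) (by fun_prop), law, Kernel.trajMeasure,
      Measure.map_comp _ _ (by fun_prop), Kernel.traj_map_frestrictLe, Kernel.partialTraj_self,
      Measure.id_comp, Measure.map_map (by fun_prop) (by fun_prop)]
    convert Measure.map_id
    ext x : 1
    exact (MeasurableEquiv.piUnique fun _ : Finset.Iic 0 => X × A).apply_symm_apply x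
  rw [← lintegral_map hg (measurable_pi_apply 0), hmap, initLaw, Measure.lintegral_compProd hg]
  simp

/-- One-step disintegration of the Ionescu-Tulcea measure. With the marginal at time `0` it is all
that is used about trajectories, so history-dependent policies never have to be shifted or
conditioned. -/
lemma lintegral_law_succ (M : MDP X A) (π : Policy X A) (μ₀ : Measure X) [IsProbabilityMeasure μ₀]
    (t : ℕ) {g : X × A → ℝ≥0∞} (hg : Measurable g) :
    ∫⁻ ω, g (ω (t + 1)) ∂(M.law π μ₀) =
      ∫⁻ ω, ∫⁻ x, ∫⁻ a, g (x, a) ∂(π.act (t + 1) (fun i => ω i, x)) ∂(M.trans (ω t))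
        ∂(M.law π μ₀) := by
  have := isProbabilityMeasure_initLaw π μ₀
  have hlaw := Kernel.map_frestrictLe_trajMeasure_compProd_eq_map_trajMeasure
    (X := fun _ => X × A) (κ := M.step π) (μ₀ := initLaw π μ₀) (a := t)
  have hprob : IsProbabilityMeasure (M.law π μ₀) := by unfold law; infer_instance
  change (M.law π μ₀).map (Preorder.frestrictLe t) ⊗ₘ M.step π t =
    (M.law π μ₀).map (fun ω => (Preorder.frestrictLe t ω, ω (t + 1))) at hlaw
  have hpair : Measurable fun ω : ℕ → X × A =>
      (Preorder.frestrictLe (π := fun _ => X × A) t ω, ω (t + 1)) := by fun_prop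
  calc ∫⁻ ω, g (ω (t + 1)) ∂(M.law π μ₀)
      = ∫⁻ p, g p.2 ∂((M.law π μ₀).map (fun ω => (Preorder.frestrictLe t ω, ω (t + 1)))) := by
        exact (lintegral_map (hg.comp measurable_snd) hpair).symm
    _ = ∫⁻ ω, ∫⁻ y, g y ∂(M.step π t (Preorder.frestrictLe t ω)) ∂(M.law π μ₀) := by
        rw [← hlaw, Measure.lintegral_compProd (f := fun p => g p.2) (by fun_prop),
          lintegral_map (by fun_prop) (by fun_prop)]
    _ = _ := by
        refine lintegral_congr fun ω => ?_
        rw [step, Kernel.lintegral_compProd _ _ _ hg]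
        rfl

/-- The law of the next state. -/
lemma lintegral_law_succ_fst (M : MDP X A) (π : Policy X A) (μ₀ : Measure X)
    [IsProbabilityMeasure μ₀] (t : ℕ) {f : X → ℝ≥0∞} (hf : Measurable f) :
    ∫⁻ ω, f (ω (t + 1)).1 ∂(M.law π μ₀) = ∫⁻ ω, ∫⁻ x, f x ∂(M.trans (ω t)) ∂(M.law π μ₀) := by
  rw [M.lintegral_law_succ π μ₀ t (g := fun p => f p.1) (by fun_prop)]
  simp

lemma lintegral_law_zero_fst (M : MDP X A) (π : Policy X A) (μ₀ : Measure X)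
    [IsProbabilityMeasure μ₀] {f : X → ℝ≥0∞} (hf : Measurable f) :
    ∫⁻ ω, f (ω 0).1 ∂(M.law π μ₀) = ∫⁻ x, f x ∂μ₀ := by
  rw [M.lintegral_law_zero π μ₀ (g := fun p => f p.1) (by fun_prop)]
  simp

/-- The law of the state-action pair under a deterministic stationary Markov policy. -/
lemma lintegral_law_markov_deterministic (M : MDP X A) {σ : X → A} (hσ : Measurable σ)
    (μ₀ : Measure X) [IsProbabilityMeasure μ₀] (t : ℕ) {g : X × A → ℝ≥0∞} (hg : Measurable g) :
    ∫⁻ ω, g (ω t) ∂(M.law (Policy.markov (Kernel.deterministic σ hσ)) μ₀) =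
      ∫⁻ ω, g ((ω t).1, σ (ω t).1) ∂(M.law (Policy.markov (Kernel.deterministic σ hσ)) μ₀) := by
  have hgσ : Measurable fun x => g (x, σ x) := by fun_prop
  have hact : ∀ s h x, ∫⁻ a, g (x, a) ∂((Policy.markov (Kernel.deterministic σ hσ)).act s (h, x)) =
      g (x, σ x) := by
    intro s h x
    simp only [Policy.markov, Kernel.comap_apply]
    exact lintegral_dirac' (σ x) (hg.comp measurable_prodMk_left)
  cases t with
  | zero => simp_rw [M.lintegral_law_zero _ μ₀ hg, M.lintegral_law_zero_fst _ μ₀ hgσ, hact]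
  | succ t => simp_rw [M.lintegral_law_succ _ μ₀ t hg, M.lintegral_law_succ_fst _ μ₀ t hgσ, hact]

lemma expectedCost_eq_tsum (M : MDP X A) (hc : Measurable M.cost) (π : Policy X A)
    (μ₀ : Measure X) :
    M.expectedCost π μ₀ =
      ∑' t : ℕ, (M.discount : ℝ≥0∞) ^ t * ∫⁻ ω, M.cost (ω t) ∂(M.law π μ₀) := by
  have hct : ∀ t, Measurable fun ω : ℕ → X × A => M.cost (ω t) := fun t =>
    hc.comp (measurable_pi_apply t)
  rw [expectedCost, lintegral_tsum fun t => ((hct t).const_mul _).aemeasurable]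
  exact tsum_congr fun t => lintegral_const_mul _ (hct t)

end Trajectories

section Bellman

variable {X A : Type*} [MeasurableSpace X] [MeasurableSpace A]

/-- The cost `c(x, a) + γ 𝔼_{x' ∼ p(· | x, a)} V(x')` of one step followed by the terminal
cost `V`. -/
noncomputable def lookahead (M : MDP X A) (V : X → ℝ≥0∞) (p : X × A) : ℝ≥0∞ :=
  M.cost p + M.discount * ∫⁻ x', V x' ∂(M.trans p)

lemma lookahead_mono (M : MDP X A) {V W : X → ℝ≥0∞} (h : V ≤ W) (p : X × A) :
    M.lookahead V p ≤ M.lookahead W p := by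
  unfold lookahead
  gcongr
  exact h _

/-- Turns pointwise Bellman inequalities into relations between expectations at times `t` and `t +
1`, ready for iteration. -/
lemma lintegral_lookahead (M : MDP X A) (hc : Measurable M.cost) (π : Policy X A)
    (μ₀ : Measure X) [IsProbabilityMeasure μ₀] (t : ℕ) {V : X → ℝ≥0∞} (hV : Measurable V) :
    ∫⁻ ω, M.lookahead V (ω t) ∂(M.law π μ₀) = ∫⁻ ω, M.cost (ω t) ∂(M.law π μ₀) +
      M.discount * ∫⁻ ω, V (ω (t + 1)).1 ∂(M.law π μ₀) := by
  have hint : Measurable fun p => ∫⁻ x', V x' ∂(M.trans p) := hV.lintegral_kernel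
  unfold lookahead
  rw [lintegral_add_left (by fun_prop), lintegral_const_mul _ (by fun_prop),
    M.lintegral_law_succ_fst π μ₀ t hV]

/-- Functions satisfying the Bellman inequalities of the finite-horizon problems are lower bounds
for the expected cost of every policy. -/
lemma lintegral_le_expectedCost (M : MDP X A) (hc : Measurable M.cost) {V : ℕ → X → ℝ≥0∞}
    (hV : ∀ n, Measurable (V n)) (hzero : V 0 = 0)
    (hle : ∀ n x a, V (n + 1) x ≤ M.lookahead (V n) (x, a)) (π : Policy X A) (μ₀ : Measure X)
    [IsProbabilityMeasure μ₀] (n : ℕ) : ∫⁻ x, V n x ∂μ₀ ≤ M.expectedCost π μ₀ := by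
  -- Quantifying over the starting time `j` lets the induction advance along one fixed trajectory
  -- law.
  have key : ∀ n j, ∫⁻ ω, V n (ω j).1 ∂(M.law π μ₀) ≤ ∑ t ∈ Finset.range n,
      (M.discount : ℝ≥0∞) ^ t * ∫⁻ ω, M.cost (ω (j + t)) ∂(M.law π μ₀) := by
    intro n
    induction n with
    | zero => simp [hzero]
    | succ n ih =>
      intro j
      calc ∫⁻ ω, V (n + 1) (ω j).1 ∂(M.law π μ₀)
          ≤ ∫⁻ ω, M.lookahead (V n) (ω j) ∂(M.law π μ₀) := lintegral_mono fun ω => hle n _ _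
        _ = _ := M.lintegral_lookahead hc π μ₀ j (hV n)
        _ ≤ _ := add_le_add_right (mul_le_mul_right (ih (j + 1)) _) _
        _ = _ := by
          rw [Finset.sum_range_succ', Finset.mul_sum, add_comm]
          simp only [pow_succ', mul_assoc, pow_zero, one_mul, add_zero, add_right_comm j,
            ← add_assoc]
  have h := key n 0
  rw [M.lintegral_law_zero_fst π μ₀ (hV n)] at h
  rw [M.expectedCost_eq_tsum hc]
  refine h.trans ?_
  simp only [zero_add]
  exact ENNReal.sum_le_tsum _

/-- If `V` dominates the one-step cost of `σ` followed by `V`, then it bounds the expected cost of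
the stationary policy `σ`. -/
lemma expectedCost_markov_deterministic_le (M : MDP X A) (hc : Measurable M.cost) {V : X → ℝ≥0∞}
    (hV : Measurable V) {σ : X → A} (hσ : Measurable σ)
    (hle : ∀ x, M.lookahead V (x, σ x) ≤ V x) (μ₀ : Measure X) [IsProbabilityMeasure μ₀] :
    M.expectedCost (Policy.markov (Kernel.deterministic σ hσ)) μ₀ ≤ ∫⁻ x, V x ∂μ₀ := by
  set π := Policy.markov (Kernel.deterministic σ hσ)
  have hlook : Measurable (M.lookahead V) := by
    have hint : Measurable fun p => ∫⁻ x', V x' ∂(M.trans p) := hV.lintegral_kernel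
    unfold lookahead
    fun_prop
  -- The terminal term `V` is dropped in the base case by nonnegativity, so no decay of `V` along
  -- trajectories is required.
  have key : ∀ n j, ∑ t ∈ Finset.range n, (M.discount : ℝ≥0∞) ^ t *
      ∫⁻ ω, M.cost (ω (j + t)) ∂(M.law π μ₀) ≤ ∫⁻ ω, V (ω j).1 ∂(M.law π μ₀) := by
    intro n
    induction n with
    | zero => simp
    | succ n ih =>
      intro j
      calc _ = ∫⁻ ω, M.cost (ω j) ∂(M.law π μ₀) + M.discount * ∑ t ∈ Finset.range n,
              (M.discount : ℝ≥0∞) ^ t * ∫⁻ ω, M.cost (ω (j + 1 + t)) ∂(M.law π μ₀) := by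
            rw [Finset.sum_range_succ', Finset.mul_sum, add_comm]
            simp only [pow_succ', mul_assoc, pow_zero, one_mul, add_zero, add_right_comm j,
              ← add_assoc]
        _ ≤ _ := add_le_add_right (mul_le_mul_right (ih (j + 1)) _) _
        _ = ∫⁻ ω, M.lookahead V (ω j) ∂(M.law π μ₀) := (M.lintegral_lookahead hc π μ₀ j hV).symm
        _ = _ := M.lintegral_law_markov_deterministic hσ μ₀ j hlook
        _ ≤ _ := lintegral_mono fun ω => hle _
  rw [M.expectedCost_eq_tsum hc, ENNReal.tsum_eq_iSup_nat]
  refine iSup_le fun n => ?_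
  have h := key n 0
  rw [M.lintegral_law_zero_fst π μ₀ hV] at h
  simpa using h

/-- A measurable function that dominates the one-step cost of `σ` followed by itself dominates the
optimal value. -/
lemma optValue_le_of_lookahead_le (M : MDP X A) (hc : Measurable M.cost) {V : X → ℝ≥0∞}
    (hV : Measurable V) {σ : X → A} (hσ : Measurable σ)
    (hle : ∀ x, M.lookahead V (x, σ x) ≤ V x) (x : X) : M.optValue x ≤ V x := by
  refine (iInf_le _ (Policy.markov (Kernel.deterministic σ hσ))).trans ?_
  refine (M.expectedCost_markov_deterministic_le hc hV hσ hle (Measure.dirac x)).trans_eq ?_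
  exact lintegral_dirac' x hV

/-- Trajectory laws do not depend on the cost, so each policy is compared with itself under one and
the same law. -/
lemma optValue_mono {M N : MDP X A} (htrans : M.trans = N.trans) (hdisc : M.discount = N.discount)
    (hcost : M.cost ≤ N.cost) : M.optValue ≤ N.optValue := by
  intro x
  refine iInf_mono fun π => ?_
  have hlaw : M.law π (Measure.dirac x) = N.law π (Measure.dirac x) := by
    have hstep : M.step π = N.step π := by
      funext t
      simp only [step, htrans]
    simp only [law, hstep]
  unfold value expectedCost
  rw [hlaw, hdisc]
  refine lintegral_mono fun ω => ENNReal.tsum_le_tsum fun t => ?_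
  gcongr
  exact hcost _

/-- A cost bounded by `C` gives optimal values bounded by `C / (1 - γ)`. -/
lemma exists_optValue_le [Nonempty A] (M : MDP X A) {C : ℝ≥0} (hC : ∀ p, M.cost p ≤ C) :
    ∃ D : ℝ≥0, ∀ x, M.optValue x ≤ D := by
  have hγ : (1 - (M.discount : ℝ≥0∞))⁻¹ ≠ ∞ := by
    rw [ENNReal.inv_ne_top]
    exact (tsub_pos_of_lt (by exact_mod_cast M.discount_lt_one)).ne'
  refine ⟨((1 - (M.discount : ℝ≥0∞))⁻¹ * C).toNNReal, fun x => ?_⟩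
  rw [ENNReal.coe_toNNReal (ENNReal.mul_ne_top hγ ENNReal.coe_ne_top)]
  let π : Policy X A := Policy.markov (Kernel.const X (Measure.dirac (Classical.arbitrary A)))
  refine (iInf_le _ π).trans ?_
  have := isProbabilityMeasure_initLaw π (Measure.dirac x)
  have hprob : IsProbabilityMeasure (M.law π (Measure.dirac x)) := by unfold law; infer_instance
  calc M.value π x ≤ ∫⁻ _, (1 - (M.discount : ℝ≥0∞))⁻¹ * C ∂(M.law π (Measure.dirac x)) := by
        refine lintegral_mono fun ω => ?_
        rw [← ENNReal.tsum_geometric, ← ENNReal.tsum_mul_right]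
        exact ENNReal.tsum_le_tsum fun t => mul_le_mul_right (hC _) _
    _ = _ := by simp

/-- The optimal values of the problems with `n` decisions and no terminal cost. -/
noncomputable def valueIteration (M : MDP X A) : ℕ → X → ℝ≥0∞
  | 0 => 0
  | n + 1 => fun x => ⨅ a, M.lookahead (valueIteration M n) (x, a)

lemma monotone_valueIteration (M : MDP X A) : Monotone M.valueIteration := by
  refine monotone_nat_of_le_succ fun n => ?_
  induction n with
  | zero => exact fun x => zero_le
  | succ n ih => exact fun x => iInf_mono fun a => M.lookahead_mono ih _

/-- The look-ahead cost is continuous along increasing sequences of costs and terminal values. -/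
lemma lookahead_iSup {M : MDP X A} {N : ℕ → MDP X A} (htrans : ∀ n, (N n).trans = M.trans)
    (hdisc : ∀ n, (N n).discount = M.discount) (hmono : Monotone fun n => (N n).cost)
    (hcost : ∀ p, M.cost p = ⨆ n, (N n).cost p) {V : ℕ → X → ℝ≥0∞}
    (hV : ∀ n, Measurable (V n)) (hVmono : Monotone V) (p : X × A) :
    M.lookahead (fun x => ⨆ n, V n x) p = ⨆ n, (N n).lookahead (V n) p := by
  unfold lookahead
  rw [lintegral_iSup hV hVmono, ENNReal.mul_iSup, hcost, ENNReal.iSup_add_iSup_of_monotone]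
  · simp_rw [htrans, hdisc]
  · exact fun m n hmn => hmono hmn p
  · intro m n hmn
    exact mul_le_mul_right (lintegral_mono (hVmono hmn)) _

end Bellman

section LowerSemicontinuous

lemma lowerSemicontinuous_lookahead {X A : Type*} [TopologicalSpace X]
    [TopologicalSpace.MetrizableSpace X] [MeasurableSpace X] [BorelSpace X] [TopologicalSpace A]
    [FirstCountableTopology A] [MeasurableSpace A] (M : MDP X A)
    (hM : ∀ u : X →ᵇ ℝ, Continuous fun p => ∫ y, u y ∂(M.trans p))
    (hc : LowerSemicontinuous M.cost) {V : X → ℝ≥0∞} (hV : LowerSemicontinuous V) :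
    LowerSemicontinuous (M.lookahead V) := by
  refine hc.add ?_
  have h := M.trans.lowerSemicontinuous_lintegral hM hV
  exact (ENNReal.continuous_const_mul ENNReal.coe_ne_top).comp_lowerSemicontinuous h
    fun a b hab => mul_le_mul_right hab _

variable {X A : Type*} [TopologicalSpace X] [TopologicalSpace.MetrizableSpace X]
  [MeasurableSpace X] [BorelSpace X]
  [TopologicalSpace A] [TopologicalSpace.MetrizableSpace A] [CompactSpace A]
  [MeasurableSpace A]

lemma lowerSemicontinuous_valueIteration (M : MDP X A)
    (hM : ∀ u : X →ᵇ ℝ, Continuous fun p => ∫ y, u y ∂(M.trans p))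
    (hc : LowerSemicontinuous M.cost) (n : ℕ) : LowerSemicontinuous (M.valueIteration n) := by
  induction n with
  | zero => exact lowerSemicontinuous_const
  | succ n ih => exact (M.lowerSemicontinuous_lookahead hM hc ih).iInf_of_compactSpace

/-- Limits of increasing sequences of solutions of Bellman recursions solve the Bellman equation
of the limiting problem. -/
lemma iSup_eq_iInf_lookahead [Nonempty A] {M : MDP X A} {N : ℕ → MDP X A}
    (hM : ∀ u : X →ᵇ ℝ, Continuous fun p => ∫ y, u y ∂(M.trans p))
    (htrans : ∀ n, (N n).trans = M.trans)
    (hdisc : ∀ n, (N n).discount = M.discount) (hmono : Monotone fun n => (N n).cost)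
    (hcost : ∀ p, M.cost p = ⨆ n, (N n).cost p) (hlsc : ∀ n, LowerSemicontinuous (N n).cost)
    {V W : ℕ → X → ℝ≥0∞} (hV : ∀ n, LowerSemicontinuous (V n)) (hVmono : Monotone V)
    (hW : ∀ n x, W n x = ⨅ a, (N n).lookahead (V n) (x, a)) (x : X) :
    ⨆ n, W n x = ⨅ a, M.lookahead (fun x => ⨆ n, V n x) (x, a) := by
  simp_rw [hW, lookahead_iSup htrans hdisc hmono hcost (fun n => (hV n).measurable) hVmono]
  refine (iInf_iSup_eq_iSup_iInf_of_lowerSemicontinuous (fun n => ?_) fun m n hmn a => ?_).symm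
  · have hM' : ∀ u : X →ᵇ ℝ, Continuous fun p => ∫ y, u y ∂((N n).trans p) := by
      simpa only [htrans] using hM
    exact ((N n).lowerSemicontinuous_lookahead hM' (hlsc n) (hV n)).comp
      (g := fun a => (x, a)) (by fun_prop)
  · change (N m).lookahead (V m) (x, a) ≤ (N n).lookahead (V n) (x, a)
    unfold lookahead
    rw [htrans, htrans, hdisc, hdisc]
    exact add_le_add (hmono hmn _) (mul_le_mul_right (lintegral_mono (hVmono hmn)) _)

/-- A lower semicontinuous solution of the Bellman equation has a measurable minimizer. -/
lemma exists_measurable_lookahead_le [Nonempty A] [BorelSpace A] (M : MDP X A)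
    (hM : ∀ u : X →ᵇ ℝ, Continuous fun p => ∫ y, u y ∂(M.trans p))
    (hc : LowerSemicontinuous M.cost) {V : X → ℝ≥0∞} (hV : LowerSemicontinuous V)
    (hVeq : ∀ x, V x = ⨅ a, M.lookahead V (x, a)) :
    ∃ σ : X → A, Measurable σ ∧ ∀ x, M.lookahead V (x, σ x) ≤ V x := by
  have hlook := M.lowerSemicontinuous_lookahead hM hc hV
  refine hlook.exists_measurable_le hV.measurable fun x => ?_
  obtain ⟨a, ha⟩ := LowerSemicontinuous.exists_eq_iInf (f := fun a => M.lookahead V (x, a))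
    (hlook.comp (g := fun a => (x, a)) (by fun_prop))
  exact ⟨a, (ha.trans (hVeq x).symm).le⟩

/-- In a discounted problem with nonnegative lower semicontinuous cost, compact action space and
weakly continuous transition law, the optimal value is lower semicontinuous, satisfies the Bellman
equation, and is attained by a deterministic stationary Markov policy. -/
theorem exists_isOptimal_markov_deterministic [SecondCountableTopology X] [Nonempty A] [BorelSpace A]
    (M : MDP X A)
    (hM : ∀ u : X →ᵇ ℝ, Continuous fun p => ∫ y, u y ∂(M.trans p))
    (hc : LowerSemicontinuous M.cost) :
    LowerSemicontinuous M.optValue ∧ (∀ x, M.optValue x = ⨅ a, M.lookahead M.optValue (x, a)) ∧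
      ∃ (σ : X → A) (hσ : Measurable σ),
        M.IsOptimal (Policy.markov (Kernel.deterministic σ hσ)) := by
  have hlsc := M.lowerSemicontinuous_valueIteration hM hc
  have hmono := M.monotone_valueIteration
  set V : X → ℝ≥0∞ := fun x => ⨆ n, M.valueIteration n x with hVdef
  have hV : LowerSemicontinuous V := lowerSemicontinuous_iSup hlsc
  have hVeq : ∀ x, V x = ⨅ a, M.lookahead V (x, a) := by
    intro x
    -- Here the sequence of problems is constant. Shifting the iteration index by one does not
    -- change the supremum of a monotone sequence.
    rw [← iSup_eq_iInf_lookahead (W := fun n => M.valueIteration (n + 1)) (N := fun _ => M) hM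
      (fun _ => rfl) (fun _ => rfl) monotone_const (fun p => ciSup_const.symm) (fun _ => hc) hlsc
      hmono fun n x => rfl]
    exact (Monotone.iSup_nat_add (fun m n hmn => hmono hmn x) 1).symm
  obtain ⟨σ, hσ, hσle⟩ := M.exists_measurable_lookahead_le hM hc hV hVeq
  -- Both bounds are against `∫ V dμ₀` for arbitrary `μ₀`: this gives optimality for all initial
  -- laws, and Dirac masses give the pointwise claims.
  have hupper : ∀ (μ₀ : Measure X) [IsProbabilityMeasure μ₀],
      M.expectedCost (Policy.markov (Kernel.deterministic σ hσ)) μ₀ ≤ ∫⁻ x, V x ∂μ₀ := fun μ₀ _ =>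
    M.expectedCost_markov_deterministic_le hc.measurable hV.measurable hσ hσle μ₀
  have hlower : ∀ (μ₀ : Measure X) [IsProbabilityMeasure μ₀] (π : Policy X A),
      ∫⁻ x, V x ∂μ₀ ≤ M.expectedCost π μ₀ := by
    intro μ₀ _ π
    rw [hVdef, lintegral_iSup (fun n => (hlsc n).measurable) hmono]
    exact iSup_le fun n => M.lintegral_le_expectedCost hc.measurable
      (fun n => (hlsc n).measurable) rfl (fun n x a => iInf_le _ a) π μ₀ n
  have hlower' : ∀ x, V x ≤ M.optValue x := fun x => le_iInf fun π =>
    (lintegral_dirac' x hV.measurable).symm.trans_le (hlower (Measure.dirac x) π)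
  have hupper' : ∀ x, M.value (Policy.markov (Kernel.deterministic σ hσ)) x ≤ V x := fun x =>
    (hupper (Measure.dirac x)).trans_eq (lintegral_dirac' x hV.measurable)
  have hopt : M.optValue = V := funext fun x =>
    le_antisymm ((iInf_le _ _).trans (hupper' x)) (hlower' x)
  rw [hopt]
  refine ⟨hV, hVeq, σ, hσ, fun x => ?_, fun μ₀ _ π => (hupper μ₀).trans (hlower μ₀ π)⟩
  exact le_antisymm ((hupper' x).trans (hlower' x)) (iInf_le _ _)

/-- The optimal value is continuous along increasing sequences of lower semicontinuous costs. -/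
theorem optValue_eq_iSup [SecondCountableTopology X] [Nonempty A] [BorelSpace A]
    {M : MDP X A} {N : ℕ → MDP X A}
    (hM : ∀ u : X →ᵇ ℝ, Continuous fun p => ∫ y, u y ∂(M.trans p))
    (htrans : ∀ n, (N n).trans = M.trans)
    (hdisc : ∀ n, (N n).discount = M.discount) (hmono : Monotone fun n => (N n).cost)
    (hcost : ∀ p, M.cost p = ⨆ n, (N n).cost p) (hlsc : ∀ n, LowerSemicontinuous (N n).cost)
    (x : X) : M.optValue x = ⨆ n, (N n).optValue x := by
  have hN : ∀ n, ∀ u : X →ᵇ ℝ, Continuous fun p => ∫ y, u y ∂((N n).trans p) := by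
    simpa only [htrans] using fun _ => hM
  have hc : LowerSemicontinuous M.cost := by
    rw [funext hcost]
    exact lowerSemicontinuous_iSup hlsc
  have hopt := fun n => (N n).exists_isOptimal_markov_deterministic (hN n) (hlsc n)
  have hle : ∀ n, (N n).optValue ≤ M.optValue := fun n =>
    optValue_mono (htrans n) (hdisc n) fun p => by
      rw [hcost]
      exact le_iSup (fun n => (N n).cost p) n
  have hoptmono : Monotone fun n => (N n).optValue := fun m n hmn =>
    optValue_mono (by simp only [htrans]) (by simp only [hdisc]) (hmono hmn)
  refine le_antisymm ?_ (iSup_le fun n => hle n x)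
  have hW : LowerSemicontinuous fun x => ⨆ n, (N n).optValue x :=
    lowerSemicontinuous_iSup fun n => (hopt n).1
  obtain ⟨σ, hσ, hσle⟩ := M.exists_measurable_lookahead_le hM hc hW
    (iSup_eq_iInf_lookahead hM htrans hdisc hmono hcost hlsc (fun n => (hopt n).1) hoptmono
      fun n => (hopt n).2.1)
  exact M.optValue_le_of_lookahead_le hc.measurable hW.measurable hσ hσle x

end LowerSemicontinuous

end MDP

/-! ### The Saute MDP -/

namespace CMDP

variable {S A : Type*} [MeasurableSpace S] [MeasurableSpace A]

lemma sauteCost_mono (M : CMDP S A) : Monotone M.sauteCost := by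
  intro m n hmn p
  unfold sauteCost
  split_ifs
  · exact le_rfl
  · exact ENat.toENNReal_le.2 hmn

/-- The offset `n₀` keeps the approximating costs in the range where lower semicontinuity is
available. -/
lemma sauteCost_top (M : CMDP S A) (n₀ : ℕ) (p : (S × ℝ) × A) :
    M.sauteCost ⊤ p = ⨆ n : ℕ, M.sauteCost ((n₀ + n : ℕ) : ℕ∞) p := by
  unfold sauteCost
  split_ifs
  · exact ciSup_const.symm
  · refine (ENNReal.eq_top_of_forall_nnreal_le fun r => ?_).symm
    obtain ⟨n, hn⟩ := exists_nat_ge r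
    refine le_trans ?_ (le_iSup (fun n : ℕ => ((((n₀ + n : ℕ) : ℕ∞) : ℝ≥0∞))) n)
    have : r ≤ ((n₀ + n : ℕ) : ℝ≥0) := hn.trans (by exact_mod_cast Nat.le_add_left n n₀)
    rw [ENat.toENNReal_coe]
    exact_mod_cast this

/-- If the reshaped cost is lower semicontinuous for `m`, it is so for every `n ≥ m`. -/
lemma lowerSemicontinuous_sauteCost_of_le [TopologicalSpace S] [TopologicalSpace A]
    (M : CMDP S A) {m n : ℕ} (hmn : m ≤ n) (h : LowerSemicontinuous (M.sauteCost m)) :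
    LowerSemicontinuous (M.sauteCost n) := by
  intro p y hy
  -- At points with `z ≥ 0` the two costs agree, and nearby the one for `n` is the larger. The
  -- region `z < 0` is open, and the cost is constant on it.
  by_cases hp : 0 ≤ p.1.2
  · have hy' : y < M.sauteCost m p := by
      simpa [sauteCost, hp] using hy
    filter_upwards [h p y hy'] with q hq
    exact hq.trans_le (M.sauteCost_mono (by exact_mod_cast hmn) q)
  · have hopen : IsOpen {q : (S × ℝ) × A | q.1.2 < 0} :=
      isOpen_lt (by fun_prop) continuous_const
    filter_upwards [hopen.mem_nhds (not_le.1 hp)] with q hq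
    have hq' : ¬ 0 ≤ q.1.2 := not_le.2 hq
    simpa [sauteCost, hp, hq'] using hy

end CMDP

theorem theorem2 {S A : Type*}
    [TopologicalSpace S] [TopologicalSpace.MetrizableSpace S] [SecondCountableTopology S]
    [MeasurableSpace S] [BorelSpace S]
    [TopologicalSpace A] [TopologicalSpace.MetrizableSpace A] [CompactSpace A] [Nonempty A]
    [MeasurableSpace A] [BorelSpace A]
    (M : CMDP S A) (hM : M.WeaklyContinuous) :
    -- (a)
    (∀ n : ℕ, M.RegularCost n →
      Measurable (M.saute n).optValue ∧
      (∃ C : ℝ≥0, ∀ x, (M.saute n).optValue x ≤ C) ∧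
      (M.saute n).SatisfiesBellman (M.saute n).optValue ∧
      ∃ (π : Kernel (S × ℝ) A) (_ : IsMarkovKernel π),
        (M.saute n).IsOptimal (Policy.markov π)) ∧
    -- (b)
    ((∃ n : ℕ, M.RegularCost n) →
      ∀ x, Monotone (fun n : ℕ => (M.saute n).optValue x) ∧
        Tendsto (fun n : ℕ => (M.saute n).optValue x) atTop
          (𝓝 ((M.saute ⊤).optValue x))) := by
  refine ⟨fun n hn => ?_, fun ⟨n₀, hn₀⟩ x => ?_⟩
  · obtain ⟨hlsc, hbellman, σ, hσ, hopt⟩ :=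
      (M.saute n).exists_isOptimal_markov_deterministic hM hn.lowerSemicontinuous
    obtain ⟨C, hC⟩ := hn.bounded
    refine ⟨hlsc.measurable, (M.saute n).exists_optValue_le hC, fun x => ⟨?_, ?_⟩,
      Kernel.deterministic σ hσ, inferInstance, hopt⟩
    · have hlook := (M.saute n).lowerSemicontinuous_lookahead hM hn.lowerSemicontinuous hlsc
      obtain ⟨a, ha⟩ := LowerSemicontinuous.exists_eq_iInf
        (f := fun a => (M.saute n).lookahead (M.saute n).optValue (x, a))
        (hlook.comp (g := fun a => (x, a)) (by fun_prop))
      exact ⟨a, ha.trans (hbellman x).symm⟩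
    · rintro _ ⟨a, rfl⟩
      exact (hbellman x).trans_le (iInf_le _ a)
  · have hmono : Monotone fun n : ℕ => (M.saute n).optValue x := fun m n hmn =>
      MDP.optValue_mono (M := M.saute m) (N := M.saute n) rfl rfl
        (M.sauteCost_mono (by exact_mod_cast hmn)) x
    refine ⟨hmono, ?_⟩
    -- Lower semicontinuity is known only from `n₀` on, so the limit is computed along this tail;
    -- monotonicity makes its supremum that of the whole sequence.
    rw [MDP.optValue_eq_iSup (M := M.saute ⊤) (N := fun n => M.saute ((n₀ + n : ℕ) : ℕ∞)) hM
      (fun _ => rfl) (fun _ => rfl)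
      (fun m n hmn => M.sauteCost_mono (by exact_mod_cast Nat.add_le_add_left hmn n₀))
      (M.sauteCost_top n₀) fun n =>
        M.lowerSemicontinuous_sauteCost_of_le (Nat.le_add_right n₀ n) hn₀.lowerSemicontinuous]
    simp_rw [Nat.add_comm n₀]
    rw [Monotone.iSup_nat_add hmono n₀]
    exact tendsto_atTop_iSup hmono
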